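/- **Setting.** Let $(T,\eta,\mu)$ be a monad on $\mathbf{Set}$ whose functor is finitary (preserves filtered colimits), and suppose that in the category $\mathbf{Set}^T$ of Eilenberg–Moore algebras finitely generated objects (objects whose covariant hom-functor preserves directed unions) are closed under kernel pairs. Let $F\colon\mathbf{Set}\to\mathbf{Set}$ be a finitary functor that weakly preserves pullbacks (maps pullback squares to weak pullback squares), and let $\bar F\colon\mathbf{Set}^T\to\mathbf{Set}^T$ be a lifting of $F$, i.e. $U\bar F=FU$ for the forgetful functor $U$. *Coalgebraic language.* Let $\nu F$ be the final $F$-coalgebra. For an $FT$-coalgebra $g\colon S\to FTS$, let $g^\sharp\colon TS\to FTS$ be the unique $T$-algebra homomorphism $(TS,\mu_S)\to\bar F(TS,\mu_S)$ with $g^\sharp\cdot\eta_S=g$, let $(g^\sharp)^\dagger\colon TS\to\nu F$ be the unique $F$-coalgebra homomorphism from $(TS,g^\sharp)$, and put $\ddagger g=(g^\sharp)^\dagger\cdot\eta_S\colon S\to\nu F$ (the coalgebraic language map of $(S,g)$). *Expressions.* For an endofunctor $H$, a coalgebra $S$ is locally finitely presentable if the forgetful functor from the category of coalgebras with finitely presentable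 carrier over $S$ to the category of finitely presentable objects over the carrier of $S$ is cofinal. Let $(\varrho(FT),r)$ be the rational fixpoint of $FT$, i.e. the final object among the locally finitely presentable $FT$-coalgebras. An expression calculus for $FT$ is a set $\mathsf{Exp}$ with a surjective map $q_0\colon\mathsf{Exp}\to\varrho(FT)$; the elements of $\mathsf{Exp}$ are called expressions, and the semantics of an expression $E$ is $[\![E]\!]=\ddagger r(q_0(E))\in\nu F$. **Theorem.** Let $q_0\colon\mathsf{Exp}\to\varrho(FT)$ be an expression calculus for $FT$. 1. For every expression $E\in\mathsf{Exp}$ there exist a finite $FT$-coalgebra $(S,g)$ and a state $s\in S$ with $\ddagger g(s)=[\![E]\!]$. 2. Conversely, for every finite $FT$-coalgebra $(S,g)$ and every state $s\in S$ there exists an expression $E\in\mathsf{Exp}$ with $\ddagger g(s)=[\![E]\!]$. -/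

import Mathlib

open CategoryTheory Limits Opposite

universe v u w

namespace CoalgLang

section General

variable {C : Type w} [Category.{v} C]

/-- An object is finitely generated if its covariant hom-functor preserves directed unions,
i.e. colimits of (small) directed diagrams of monomorphisms. -/
def IsFinitelyGenerated (X : C) : Prop :=
  ∀ (J : Type v) [Preorder J] [IsDirectedOrder J] [Nonempty J] (D : J ⥤ C),
    (∀ {i j : J} (f : i ⟶ j), Mono (D.map f)) →
      PreservesColimit D (coyoneda.obj (op X))

variable (C) in
/-- Finitely generated objects are closed under kernel pairs (of morphisms between finitely
generated objects). -/
def FinitelyGeneratedClosedUnderKernelPairs : Prop :=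
  ∀ ⦃X Y R : C⦄ (f : X ⟶ Y) (k₁ k₂ : R ⟶ X), IsKernelPair f k₁ k₂ →
    IsFinitelyGenerated X → IsFinitelyGenerated Y → IsFinitelyGenerated R

/-- A functor weakly preserves pullbacks if it sends pullback squares to weak pullback squares. -/
def WeaklyPreservesPullbacks (F : C ⥤ C) : Prop :=
  ∀ ⦃P X Y Z : C⦄ ⦃p₁ : P ⟶ X⦄ ⦃p₂ : P ⟶ Y⦄ ⦃f : X ⟶ Z⦄ ⦃g : Y ⟶ Z⦄
    (h : IsPullback p₁ p₂ f g),
    Nonempty (IsWeakLimit (PullbackCone.mk (f := F.map f) (g := F.map g) (F.map p₁) (F.map p₂)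
      (by rw [← F.map_comp, ← F.map_comp, h.w])))

/-- The full subcategory of finitely presentable objects. -/
abbrev FpObj (C : Type w) [Category.{v} C] :=
  (ObjectProperty.isFinitelyPresentable.{v} C).FullSubcategory

/-- The category of coalgebras with finitely presentable carrier. -/
abbrev FpCoalgebra (F : C ⥤ C) :=
  ((ObjectProperty.isFinitelyPresentable.{v} C).inverseImage
    (Endofunctor.Coalgebra.forget F)).FullSubcategory

/-- The forgetful functor from coalgebras with finitely presentable carrier to finitely
presentable objects. -/
def FpCoalgebra.forget (F : C ⥤ C) : FpCoalgebra F ⥤ FpObj C :=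
  ObjectProperty.lift _ (ObjectProperty.ι _ ⋙ Endofunctor.Coalgebra.forget F) (fun P => P.property)

/-- The forgetful functor from the comma category of `FpCoalgebra F` over a coalgebra `S` to the
comma category of `FpObj C` over the carrier of `S`. -/
def overForget (F : C ⥤ C) (S : Endofunctor.Coalgebra F) :
    CostructuredArrow (ObjectProperty.ι _ : FpCoalgebra F ⥤ Endofunctor.Coalgebra F) S ⥤
      CostructuredArrow (ObjectProperty.ι _ : FpObj C ⥤ C) S.V :=
  CostructuredArrow.map₂ (F := FpCoalgebra.forget F) (G := Endofunctor.Coalgebra.forget F)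
    (𝟙 _) (𝟙 _)

/-- A coalgebra `S` is locally finitely presentable if the forgetful functor `overForget F S` is
cofinal (in Mathlib's terminology: a final functor). -/
def IsLocallyFinitelyPresentable {F : C ⥤ C} (S : Endofunctor.Coalgebra F) : Prop :=
  (overForget F S).Final

/-- The rational fixpoint: the final locally finitely presentable coalgebra. -/
structure IsRationalFixpoint {F : C ⥤ C} (R : Endofunctor.Coalgebra F) : Prop where
  lfp : IsLocallyFinitelyPresentable R
  unique_hom : ∀ S : Endofunctor.Coalgebra F, IsLocallyFinitelyPresentable S →
    Nonempty (Unique (S ⟶ R))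

/-- Transport of an algebra structure along an isomorphism of carriers. -/
def transportAlgebra {T : Monad C} (A : T.Algebra) {X : C} (e : A.A ≅ X) : T.Algebra where
  A := X
  a := T.map e.inv ≫ A.a ≫ e.hom
  unit := by
    have h := T.η.naturality e.inv
    simp only [Functor.id_map] at h
    rw [← reassoc_of% h, A.unit_assoc, e.inv_hom_id]
  assoc := by
    have h := T.μ.naturality e.inv
    simp only [Functor.comp_map] at h
    rw [← reassoc_of% h, A.assoc_assoc]
    simp only [Functor.map_comp, Category.assoc, ← T.map_comp_assoc e.hom, e.hom_inv_id]
    simp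

/-- A lifting of the endofunctor `F` to the category of Eilenberg-Moore algebras of `T`:
an endofunctor `F̄` of the category of algebras with `U F̄ = F U`, where `U` is the forgetful
functor. -/
structure Lifting (T : Monad C) (F : C ⥤ C) where
  functor : T.Algebra ⥤ T.Algebra
  comm : functor ⋙ T.forget = T.forget ⋙ F

namespace Lifting

variable {T : Monad C} {F : C ⥤ C} (L : Lifting T F)

/-- The equality `U (F̄ B) = F (U B)`, as an isomorphism. -/
def carrierIso (B : T.Algebra) : (L.functor.obj B).A ≅ F.obj B.A :=
  (eqToIso L.comm).app B

/-- The algebra `F̄ B`, with its carrier written as `F.obj B.A`. -/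
def algebra (B : T.Algebra) : T.Algebra :=
  transportAlgebra (L.functor.obj B) (L.carrierIso B)

end Lifting

/-- The homomorphic extension `f♯ = α ∘ T f : T X ⟶ A` of `f : X ⟶ A` for an algebra `(A, α)`. -/
def freeExt {T : Monad C} {X : C} (A : T.Algebra) (f : X ⟶ A.A) : T.obj X ⟶ A.A :=
  T.map f ≫ A.a

/-- Generalised powerset construction: the `FT`-coalgebra `c : X ⟶ F (T X)` is turned into the
`F`-coalgebra `c♯ : T X ⟶ F (T X)`, where `F (T X)` is the algebra `F̄ (T X, μ)`. -/
def determinization {T : Monad C} {F : C ⥤ C} (L : Lifting T F)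
    (S : Endofunctor.Coalgebra (T.toFunctor ⋙ F)) : Endofunctor.Coalgebra F where
  V := T.obj S.V
  str := freeExt (L.algebra (T.free.obj S.V)) S.str

/-- The coalgebraic language map of an `FT`-coalgebra `S`: the unit of the monad followed by the
unique homomorphism from the determinization of `S` to the final `F`-coalgebra. -/
def languageMap {T : Monad C} {F : C ⥤ C} (L : Lifting T F) {N : Endofunctor.Coalgebra F}
    (hN : IsTerminal N) (S : Endofunctor.Coalgebra (T.toFunctor ⋙ F)) : S.V ⟶ N.V :=
  T.η.app S.V ≫ (hN.from (determinization L S)).f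

end General

/-- The semantics of expressions: the map `q₀` to the rational fixpoint `R` of `FT` followed by
the coalgebraic language map of `R`. -/
def semantics {T : Monad (Type u)} {F : Type u ⥤ Type u} (L : Lifting T F)
    {N : Endofunctor.Coalgebra F} (hN : IsTerminal N)
    {R : Endofunctor.Coalgebra (T.toFunctor ⋙ F)} {Exp : Type w} (q₀ : Exp → R.V) (E : Exp) :
    N.V :=
  languageMap L hN R (q₀ E)

/-! Existence: for finitary endofunctors of sets the final coalgebra and the rational fixpoint
exist, so that a statement about all of them is not vacuous. -/

section Existence

/-- Every homomorphism out of `Q` is injective. -/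
def IsSimple {H : Type u ⥤ Type u} (Q : Endofunctor.Coalgebra H) : Prop :=
  ∀ (E : Endofunctor.Coalgebra H) (f : Q ⟶ E), Function.Injective f.f

lemma map_inj {H : Type u ⥤ Type u} {X Y : Type u} (m : X ⟶ Y) (hm : Function.Injective m)
    (x : X) : Function.Injective (H.map m) := by
  have : Nonempty X := ⟨x⟩
  have h : m ≫ ↾(Function.invFun m) = 𝟙 X := by
    ext a
    exact Function.leftInverse_invFun hm a
  have h2 : H.map m ≫ H.map (↾(Function.invFun m)) = 𝟙 _ := by
    rw [← H.map_comp, h, H.map_id]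
  intro a b hab
  have ha := types_congr_hom h2 a
  have hb := types_congr_hom h2 b
  simp only [types_comp_apply, types_id_apply] at ha hb
  rw [← ha, ← hb, hab]

lemma hom_apply {H : Type u ⥤ Type u} {A B : Endofunctor.Coalgebra H} (f : A ⟶ B) (x : A.V) :
    B.str (f.f x) = H.map f.f (A.str x) := (types_congr_hom f.h x).symm

def quotMk {X : Type u} (r : Setoid X) : X ⟶ Quotient r := ↾(Quotient.mk r)

lemma quotMk_surj {X : Type u} (r : Setoid X) : Function.Surjective (quotMk r) := Quotient.mk_surjective

/-- The quotient map of `r` carries a coalgebra structure. -/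
def IsCongruence {H : Type u ⥤ Type u} (C : Endofunctor.Coalgebra H) (r : Setoid C.V) : Prop :=
  ∀ x y, r x y → H.map (quotMk r) (C.str x) = H.map (quotMk r) (C.str y)

/-- Quotient coalgebra. -/
def quot {H : Type u ⥤ Type u} (C : Endofunctor.Coalgebra H) (r : Setoid C.V) (hr : IsCongruence C r) :
    Endofunctor.Coalgebra H where
  V := Quotient r
  str := ↾(Quotient.lift (fun x => H.map (quotMk r) (C.str x)) hr)

def quotHom {H : Type u ⥤ Type u} (C : Endofunctor.Coalgebra H) (r : Setoid C.V) (hr : IsCongruence C r) :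
    C ⟶ quot C r hr where
  f := quotMk r
  h := by ext x; rfl

lemma congr_ker {H : Type u ⥤ Type u} {C E : Endofunctor.Coalgebra H} (f : C ⟶ E) :
    IsCongruence C (Setoid.ker f.f) := by
  intro x y hxy
  let m : Quotient (Setoid.ker f.f) ⟶ E.V := ↾(Quotient.lift (fun x => f.f x) (fun _ _ h => h))
  have hm : Function.Injective m := by
    rintro ⟨a⟩ ⟨b⟩ h
    exact Quotient.sound h
  have hf : quotMk (Setoid.ker f.f) ≫ m = f.f := by ext x; rfl
  apply map_inj (H := H) m hm (quotMk _ x)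
  rw [← H.map_comp_apply, ← H.map_comp_apply, hf, ← hom_apply, ← hom_apply]
  exact congrArg _ hxy

lemma congr_gen {H : Type u ⥤ Type u} (C : Endofunctor.Coalgebra H) (R : C.V → C.V → Prop) (s : Setoid C.V)
    (hs : ∀ r : Setoid C.V, (∀ x y, R x y → r x y) → s ≤ r)
    (h : ∀ x y, R x y → H.map (quotMk s) (C.str x) = H.map (quotMk s) (C.str y)) : IsCongruence C s := by
  have := hs (Setoid.ker (fun x => H.map (quotMk s) (C.str x))) h
  intro x y hxy
  exact this hxy

/-- Every coalgebra has a simple quotient. -/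
lemma exists_simple {H : Type u ⥤ Type u} (C : Endofunctor.Coalgebra H) :
    ∃ (Q : Endofunctor.Coalgebra H) (p : C ⟶ Q), Function.Surjective p.f ∧ IsSimple Q := by
  let s : Setoid C.V := sSup {r | IsCongruence C r}
  have hle : ∀ r, IsCongruence C r → r ≤ s := fun r hr => le_sSup hr
  have hs : IsCongruence C s := by
    refine congr_gen C (fun x y => ∃ r, IsCongruence C r ∧ r x y) s ?_ ?_
    · intro r hr
      exact sSup_le fun r' hr' x y hxy => hr _ _ ⟨r', hr', hxy⟩
    · rintro x y ⟨r, hr, hxy⟩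
      let j : Quotient r ⟶ Quotient s := ↾(Quotient.map' id (fun _ _ h => hle r hr h))
      have hj : quotMk s = quotMk r ≫ j := by ext x; rfl
      rw [hj, H.map_comp, types_comp_apply, types_comp_apply, hr x y hxy]
  refine ⟨quot C s hs, quotHom C s hs, quotMk_surj _, fun E f => ?_⟩
  rintro ⟨a⟩ ⟨b⟩ hab
  exact Quotient.sound (hle _ (congr_ker (quotHom C s hs ≫ f)) hab)

lemma simple_unique {H : Type u ⥤ Type u} {Q D : Endofunctor.Coalgebra H} (hQ : IsSimple Q) (a b : D ⟶ Q) :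
    a = b := by
  let t : Setoid Q.V := Relation.EqvGen.setoid (fun x y => ∃ d, a.f d = x ∧ b.f d = y)
  have ht' : ∀ d, t (a.f d) (b.f d) := fun d => Relation.EqvGen.rel _ _ ⟨d, rfl, rfl⟩
  have hab : a.f ≫ quotMk t = b.f ≫ quotMk t := by
    ext d; exact Quotient.sound (ht' d)
  have ht : IsCongruence Q t := by
    refine congr_gen Q (fun x y => ∃ d, a.f d = x ∧ b.f d = y) t ?_ ?_
    · intro r hr x y h
      exact Setoid.eqvGen_le hr h
    · rintro _ _ ⟨d, rfl, rfl⟩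
      rw [hom_apply, hom_apply, ← H.map_comp_apply, ← H.map_comp_apply, hab]
  ext d
  exact hQ _ (quotHom Q t ht) (Quotient.sound (ht' d))

/-- Coproduct of coalgebras. -/
def coprod {H : Type u ⥤ Type u} {ι : Type u} (D : ι → Endofunctor.Coalgebra H) : Endofunctor.Coalgebra H where
  V := Σ i, (D i).V
  str := ↾fun p => H.map (↾fun x => ⟨p.1, x⟩) ((D p.1).str p.2)

def coprodIn {H : Type u ⥤ Type u} {ι : Type u} (D : ι → Endofunctor.Coalgebra H) (i : ι) :
    D i ⟶ coprod D where
  f := ↾fun x => ⟨i, x⟩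
  h := by ext x; rfl

def coprodDesc {H : Type u ⥤ Type u} {ι : Type u} (D : ι → Endofunctor.Coalgebra H) {E : Endofunctor.Coalgebra H}
    (f : ∀ i, D i ⟶ E) : coprod D ⟶ E where
  f := ↾fun p => (f p.1).f p.2
  h := by
    ext ⟨i, x⟩
    have h1 : (↾fun x => (⟨i, x⟩ : Σ i, (D i).V)) ≫ (↾fun p : (Σ i, (D i).V) => (f p.1).f p.2) =
      (f i).f := by ext; rfl
    have := hom_apply (f i) x
    rw [← h1, H.map_comp, types_comp_apply] at this
    exact this.symm

/-- A simple coalgebra receives a homomorphism from each coalgebra that is covered. -/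
lemma exists_hom {H : Type u ⥤ Type u} {Q D : Endofunctor.Coalgebra H} (hQ : IsSimple Q)
    (h : ∀ x : D.V, ∃ (E : Endofunctor.Coalgebra H) (g : E ⟶ D) (_ : E ⟶ Q) (y : E.V), g.f y = x) :
    Nonempty (D ⟶ Q) := by
  obtain ⟨S, p, -, hS⟩ := exists_simple (coprod (fun b : ULift.{u} Bool => if b.down then D else Q))
  let p₁ : D ⟶ S := coprodIn (fun b : ULift.{u} Bool => if b.down then D else Q) ⟨true⟩ ≫ p
  let k : Q ⟶ S := coprodIn (fun b : ULift.{u} Bool => if b.down then D else Q) ⟨false⟩ ≫ p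
  have hk : Function.Injective k.f := hQ _ k
  have hx : ∀ x, ∃ q, k.f q = p₁.f x := by
    intro x
    obtain ⟨E, g, e, y, rfl⟩ := h x
    refine ⟨e.f y, ?_⟩
    have := simple_unique hS (e ≫ k) (g ≫ p₁)
    exact types_congr_hom (congrArg (fun f => f.f) this) y
  choose φ hφ using hx
  have hφ' : ↾φ ≫ k.f = p₁.f := by ext x; exact hφ x
  refine ⟨⟨↾φ, ?_⟩⟩
  ext x
  apply map_inj (H := H) k.f hk (φ x)
  have h1 := hom_apply k (φ x)
  rw [hφ, hom_apply, ← hφ', H.map_comp, types_comp_apply] at h1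
  exact h1

/-- Transport of a coalgebra structure along an equivalence. -/
def pull {H : Type u ⥤ Type u} (C : Endofunctor.Coalgebra H) {X : Type u} (e : X ≃ C.V) : Endofunctor.Coalgebra H where
  V := X
  str := ↾e ≫ C.str ≫ H.map (↾e.symm)

def pullHom {H : Type u ⥤ Type u} (C : Endofunctor.Coalgebra H) {X : Type u} (e : X ≃ C.V) :
    pull C e ⟶ C where
  f := ↾e
  h := by
    have : (↾e.symm : C.V ⟶ X) ≫ ↾e = 𝟙 _ := by ext x; exact e.apply_symm_apply x
    simp only [pull, Category.assoc, ← H.map_comp, this]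
    simp

def pullInv {H : Type u ⥤ Type u} (C : Endofunctor.Coalgebra H) {X : Type u} (e : X ≃ C.V) :
    C ⟶ pull C e where
  f := ↾e.symm
  h := by
    have : (↾e.symm : C.V ⟶ X) ≫ ↾e = 𝟙 _ := by ext x; exact e.apply_symm_apply x
    simp only [pull, ← Category.assoc, this]
    simp

/-- For a class `P` of small sets, a simple coalgebra receiving all coalgebras with carrier
equivalent to one in `P`. -/
lemma exists_cover (H : Type u ⥤ Type u) (P : Set (Set (ULift.{u} ℕ))) :
    ∃ (ι : Type u) (D : ι → Endofunctor.Coalgebra H) (Q : Endofunctor.Coalgebra H) (p : coprod D ⟶ Q),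
      Function.Surjective p.f ∧ IsSimple Q ∧
      (∀ i, ∃ A ∈ P, (D i).V = A) ∧
      ∀ (E : Endofunctor.Coalgebra H) (A : Set (ULift.{u} ℕ)) (_ : A ∈ P) (_ : A ≃ E.V),
        Nonempty (E ⟶ Q) := by
  let D : (Σ A : P, (A.1 : Type u) ⟶ H.obj A.1) → Endofunctor.Coalgebra H := fun i => ⟨i.1.1, i.2⟩
  obtain ⟨Q, p, hp, hQ⟩ := exists_simple (coprod D)
  refine ⟨_, D, Q, p, hp, hQ, fun i => ⟨i.1.1, i.1.2, rfl⟩, fun E A hA e => ⟨?_⟩⟩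
  exact pullInv E e ≫ coprodIn D ⟨⟨A, hA⟩, (pull E e).str⟩ ≫ p

lemma exists_finite_support {H : Type u ⥤ Type u} [PreservesFilteredColimits H] {X : Type u}
    (z : H.obj X) : ∃ A : Set X, A.Finite ∧ ∃ w : H.obj A, H.map (↾(Subtype.val)) w = z := by
  have := HasCardinalLT.Set.isFiltered_of_aleph0_le X Cardinal.aleph0 le_rfl
  have hc := isColimitOfPreserves H
    (HasCardinalLT.Set.isColimitCocone X Cardinal.aleph0 le_rfl)
  obtain ⟨⟨A, hA⟩, w, hw⟩ := Types.jointly_surjective_of_isColimit hc z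
  refine ⟨A, ?_, w, hw⟩
  rw [hasCardinalLT_aleph0_iff] at hA
  exact Set.toFinite A

lemma exists_countable_sub {H : Type u ⥤ Type u} [PreservesFilteredColimits H]
    (C : Endofunctor.Coalgebra H) (x : C.V) :
    ∃ (E : Endofunctor.Coalgebra H) (g : E ⟶ C) (y : E.V), Countable E.V ∧ g.f y = x := by
  choose A hA w hw using fun x : C.V => exists_finite_support (C.str x)
  let B : ℕ → Set C.V := fun n => Nat.rec {x} (fun _ S => ⋃ a ∈ S, A a) n
  have hB : ∀ n, (B n).Countable := by
    intro n
    induction n with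
    | zero => exact Set.countable_singleton x
    | succ n ih => exact ih.biUnion (fun a _ => (hA a).countable)
  let U : Set C.V := ⋃ n, B n
  have hU : U.Countable := Set.countable_iUnion hB
  have hAU : ∀ a ∈ U, A a ⊆ U := by
    intro a ha b hb
    obtain ⟨n, hn⟩ := Set.mem_iUnion.1 ha
    exact Set.mem_iUnion.2 ⟨n + 1, Set.mem_biUnion hn hb⟩
  let E : Endofunctor.Coalgebra H := ⟨U, ↾fun a => H.map (↾(Set.inclusion (hAU a.1 a.2))) (w a.1)⟩
  refine ⟨E, ⟨↾(Subtype.val), ?_⟩, ⟨x, Set.mem_iUnion.2 ⟨0, rfl⟩⟩, hU.to_subtype, rfl⟩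
  ext a
  have : ↾(Set.inclusion (hAU a.1 a.2)) ≫ (↾(Subtype.val) : (U : Type u) ⟶ C.V) =
    ↾(Subtype.val) := by ext; rfl
  have h2 := hw a.1
  rw [← this, H.map_comp, types_comp_apply] at h2
  exact h2

lemma countable_equiv (X : Type u) [Countable X] : ∃ A : Set (ULift.{u} ℕ), Nonempty (A ≃ X) := by
  obtain ⟨f, hf⟩ := exists_injective_nat X
  refine ⟨Set.range (fun x => ULift.up (f x)), ⟨(Equiv.ofInjective _ ?_).symm⟩⟩
  intro a b h
  exact hf (ULift.up_injective h)

/-- A finitary endofunctor of sets has a final coalgebra. -/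
theorem exists_final_coalgebra (H : Type u ⥤ Type u) [PreservesFilteredColimits H] :
    ∃ N : Endofunctor.Coalgebra H, Nonempty (IsTerminal N) := by
  obtain ⟨ι, D, Q, p, -, hQ, -, h⟩ := exists_cover H Set.univ
  refine ⟨Q, ⟨IsTerminal.ofUniqueHom (fun C => Classical.choice ?_)
    (fun _ _ => simple_unique hQ _ _)⟩⟩
  apply exists_hom hQ
  intro x
  obtain ⟨E, g, y, hE, hy⟩ := exists_countable_sub C x
  obtain ⟨A, ⟨e⟩⟩ := countable_equiv E.V
  obtain ⟨k⟩ := h E A trivial e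
  exact ⟨E, g, k, y, hy⟩


lemma isFinitelyPresentable_iff_finite (X : Type u) : IsFinitelyPresentable.{u} X ↔ Finite X := by
  have := Cardinal.fact_isRegular_aleph0.{u}
  exact (Types.isCardinalPresentable_iff Cardinal.aleph0).trans (hasCardinalLT_aleph0_iff X)

lemma exists_finite_cover {H : Type u ⥤ Type u} {S : Endofunctor.Coalgebra H} (hS : IsLocallyFinitelyPresentable S)
    (x : S.V) : ∃ (E : Endofunctor.Coalgebra H) (g : E ⟶ S) (y : E.V), Finite E.V ∧ g.f y = x := by
  let d : CostructuredArrow (ObjectProperty.ι _ : FpObj (Type u) ⥤ Type u) S.V :=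
    CostructuredArrow.mk (Y := ⟨PUnit, (isFinitelyPresentable_iff_finite _).2 inferInstance⟩) (↾fun _ => x)
  have := hS
  obtain ⟨s⟩ := (hS.out d).is_nonempty
  refine ⟨s.right.left.obj, s.right.hom, s.hom.left.hom PUnit.unit,
    (isFinitelyPresentable_iff_finite _).1 s.right.left.property, ?_⟩
  have := CostructuredArrow.w s.hom
  exact types_congr_hom this PUnit.unit

lemma exists_image {H : Type u ⥤ Type u} {P S : Endofunctor.Coalgebra H} (f : P ⟶ S) :
    ∃ (I : Endofunctor.Coalgebra H) (e : P ⟶ I) (m : I ⟶ S), Function.Surjective e.f ∧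
      Function.Injective m.f ∧ e ≫ m = f := by
  refine ⟨quot P _ (congr_ker f), quotHom P _ (congr_ker f),
    ⟨↾(Quotient.lift (fun x => f.f x) (fun _ _ h => h)), ?_⟩, quotMk_surj _, ?_, ?_⟩
  · ext ⟨x⟩
    let m : Quotient (Setoid.ker f.f) ⟶ S.V := ↾(Quotient.lift (fun x => f.f x) (fun _ _ h => h))
    have hm : quotMk _ ≫ m = f.f := by ext; rfl
    have := hom_apply f x
    rw [← hm, H.map_comp_apply] at this
    exact this.symm
  · rintro ⟨a⟩ ⟨b⟩ h
    exact Quotient.sound h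
  · ext x; rfl

/-- A coalgebra of sets covered by images of finite coalgebras is locally finitely presentable. -/
lemma isLocallyFinitelyPresentable_of_cover {H : Type u ⥤ Type u} {S : Endofunctor.Coalgebra H}
    (h : ∀ x : S.V, ∃ (E : Endofunctor.Coalgebra H) (g : E ⟶ S) (y : E.V), Finite E.V ∧ g.f y = x) :
    IsLocallyFinitelyPresentable S := by
  let G := overForget H S
  let mk' : ∀ (P : Endofunctor.Coalgebra H) (_ : Finite P.V) (_ : P ⟶ S),
    CostructuredArrow (ObjectProperty.ι _ : FpCoalgebra H ⥤ Endofunctor.Coalgebra H) S :=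
    fun P hP f =>
      let Y : FpCoalgebra H := ⟨P, (isFinitelyPresentable_iff_finite P.V).2 hP⟩
      let f' : (ObjectProperty.ι _ : FpCoalgebra H ⥤ Endofunctor.Coalgebra H).obj Y ⟶ S := f
      CostructuredArrow.mk f'
  have hfin : ∀ P : CostructuredArrow (ObjectProperty.ι _ : FpCoalgebra H ⥤ Endofunctor.Coalgebra H) S,
    Finite P.left.obj.V := fun P => (isFinitelyPresentable_iff_finite _).1 P.left.property
  -- every object maps to a monic one
  have him : ∀ P, ∃ (I : CostructuredArrow (ObjectProperty.ι _ : FpCoalgebra H ⥤ Endofunctor.Coalgebra H) S)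
      (_ : P ⟶ I), Function.Injective I.hom.f := by
    intro P
    obtain ⟨I, e, m, he, hm, hem⟩ := exists_image P.hom
    have : Finite ((ObjectProperty.ι _ : FpCoalgebra H ⥤ Endofunctor.Coalgebra H).obj P.left).V := hfin P
    refine ⟨mk' I (Finite.of_surjective _ he) m, CostructuredArrow.homMk ⟨e⟩ hem, hm⟩
  have hmono : ∀ {P I : CostructuredArrow (ObjectProperty.ι _ : FpCoalgebra H ⥤ Endofunctor.Coalgebra H) S}
      (_ : Function.Injective I.hom.f) (u v : P ⟶ I), u = v := by
    intro P I hI u v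
    ext x
    apply hI
    have h1 := types_congr_hom (congrArg (fun f => f.f) (CostructuredArrow.w u)) x
    have h2 := types_congr_hom (congrArg (fun f => f.f) (CostructuredArrow.w v)) x
    exact h1.trans h2.symm
  have hcoprod : ∀ {ι : Type u} [Finite ι] (D : ι → Endofunctor.Coalgebra H), (∀ i, Finite (D i).V) →
      Finite (coprod D).V := by
    intro ι _ D hD
    exact inferInstanceAs (Finite (Σ i, (D i).V))
  have : IsFiltered (CostructuredArrow
      (ObjectProperty.ι _ : FpCoalgebra H ⥤ Endofunctor.Coalgebra H) S) := by
    refine { cocone_objs := fun P P' => ?_, cocone_maps := fun P P' u v => ?_, nonempty := ?_ }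
    · let D : ULift.{u} Bool → Endofunctor.Coalgebra H :=
        fun b => if b.down then P.left.obj else P'.left.obj
      let f : ∀ b, D b ⟶ S := fun b => match b with
        | ⟨true⟩ => P.hom
        | ⟨false⟩ => P'.hom
      have hf : Finite (coprod D).V := hcoprod D (by
        rintro ⟨_ | _⟩
        · exact hfin P'
        · exact hfin P)
      refine ⟨mk' _ hf (coprodDesc D f),
        CostructuredArrow.homMk ⟨coprodIn D ⟨true⟩⟩ ?_,
        CostructuredArrow.homMk ⟨coprodIn D ⟨false⟩⟩ ?_, trivial⟩
      · ext x; rfl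
      · ext x; rfl
    · obtain ⟨I, e, hI⟩ := him P'
      exact ⟨I, e, hmono hI _ _⟩
    · exact ⟨mk' (coprod (fun i : PEmpty.{u+1} => i.elim)) (hcoprod _ (fun i => i.elim))
        (coprodDesc _ (fun i => i.elim))⟩
  apply Functor.final_of_exists_of_isFiltered
  · intro d
    choose E g y hE hy using h
    let X : Type u := d.left.obj
    have hX : Finite X := (isFinitelyPresentable_iff_finite _).1 d.left.property
    let D : X → Endofunctor.Coalgebra H := fun x => E (d.hom x)
    refine ⟨mk' (coprod D) (hcoprod _ (fun i => hE _)) (coprodDesc D (fun x => g (d.hom x))), ⟨?_⟩⟩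
    refine CostructuredArrow.homMk ⟨↾fun x : X => (⟨x, y (d.hom x)⟩ : Σ x, (D x).V)⟩ ?_
    ext x
    exact hy _
  · intro d P s s'
    obtain ⟨I, e, hI⟩ := him P
    refine ⟨I, e, ?_⟩
    ext x
    apply hI
    have h1 := types_congr_hom (CostructuredArrow.w (s ≫ (overForget H S).map e)) x
    have h2 := types_congr_hom (CostructuredArrow.w (s' ≫ (overForget H S).map e)) x
    exact h1.trans h2.symm

/-- An endofunctor of sets has a rational fixpoint. -/
theorem exists_rationalFixpoint (H : Type u ⥤ Type u) :
    ∃ R : Endofunctor.Coalgebra H, IsRationalFixpoint R := by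
  obtain ⟨ι, D, Q, p, hp, hQ, hD, h⟩ := exists_cover H {A | A.Finite}
  refine ⟨Q, isLocallyFinitelyPresentable_of_cover fun x => ?_, fun S hS => ?_⟩
  · obtain ⟨⟨i, z⟩, rfl⟩ := hp x
    obtain ⟨A, hA, hDA⟩ := hD i
    refine ⟨D i, coprodIn D i ≫ p, z, ?_, rfl⟩
    rw [hDA]
    exact hA.to_subtype
  · have : Nonempty (S ⟶ Q) := by
      apply exists_hom hQ
      intro x
      obtain ⟨E, g, y, hE, hy⟩ := exists_finite_cover hS x
      obtain ⟨A, ⟨e⟩⟩ := countable_equiv E.V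
      obtain ⟨k⟩ := h E A (Set.finite_coe_iff.1 (Finite.of_equiv _ e.symm)) e
      exact ⟨E, g, k, y, hy⟩
    obtain ⟨f⟩ := this
    exact ⟨⟨⟨f⟩, fun _ => simple_unique hQ _ _⟩⟩

end Existence

end CoalgLang

namespace CoalgLang

section Naturality

variable {C : Type w} [Category.{v} C] {T : Monad C} {F : C ⥤ C}

/-- A lifting sends algebra homomorphisms to algebra homomorphisms. -/
lemma Lifting.algebra_a_map (L : Lifting T F) {A B : T.Algebra} (h : A ⟶ B) :
    (L.algebra A).a ≫ F.map h.f = T.map (F.map h.f) ≫ (L.algebra B).a := by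
  have nat : (L.functor.map h).f ≫ (L.carrierIso B).hom = (L.carrierIso A).hom ≫ F.map h.f :=
    (eqToIso L.comm).hom.naturality h
  have nat' : (L.carrierIso A).inv ≫ (L.functor.map h).f = F.map h.f ≫ (L.carrierIso B).inv := by
    rw [Iso.inv_comp_eq, ← Category.assoc, ← nat, Category.assoc, Iso.hom_inv_id,
      Category.comp_id]
  change (T.map (L.carrierIso A).inv ≫ (L.functor.obj A).a ≫ (L.carrierIso A).hom) ≫ F.map h.f =
    T.map (F.map h.f) ≫ T.map (L.carrierIso B).inv ≫ (L.functor.obj B).a ≫ (L.carrierIso B).hom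
  rw [← T.map_comp_assoc, ← nat', T.map_comp_assoc, Category.assoc, Category.assoc, ← nat,
    (L.functor.map h).h_assoc]

/-- Homomorphic extensions are compatible with algebra homomorphisms. -/
lemma freeExt_comp {X : C} {A B : T.Algebra} (f : X ⟶ A.A) (h : A.A ⟶ B.A)
    (hh : A.a ≫ h = T.map h ≫ B.a) : freeExt A f ≫ h = freeExt B (f ≫ h) := by
  simp only [freeExt, Category.assoc, hh, T.map_comp]

lemma map_comp_freeExt {X Y : C} {A : T.Algebra} (g : X ⟶ Y) (f : Y ⟶ A.A) :
    T.map g ≫ freeExt A f = freeExt A (g ≫ f) := by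
  simp only [freeExt, Category.assoc, T.map_comp]

/-- The generalised powerset construction is functorial. -/
def determinizationMap (L : Lifting T F) {S S' : Endofunctor.Coalgebra (T.toFunctor ⋙ F)}
    (f : S ⟶ S') : determinization L S ⟶ determinization L S' where
  f := T.map f.f
  h := (freeExt_comp (A := L.algebra (T.free.obj S.V)) (B := L.algebra (T.free.obj S'.V))
      S.str (F.map (T.map f.f)) (L.algebra_a_map (T.free.map f.f))).trans
    ((congrArg (freeExt (L.algebra (T.free.obj S'.V))) f.h).trans
      (map_comp_freeExt (A := L.algebra (T.free.obj S'.V)) f.f S'.str).symm)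

/-- Coalgebra homomorphisms preserve the coalgebraic language. -/
lemma comp_languageMap (L : Lifting T F) {N : Endofunctor.Coalgebra F} (hN : IsTerminal N)
    {S S' : Endofunctor.Coalgebra (T.toFunctor ⋙ F)} (f : S ⟶ S') :
    f.f ≫ languageMap L hN S' = languageMap L hN S := by
  have h : (determinizationMap L f).f ≫ (hN.from (determinization L S')).f =
      (hN.from (determinization L S)).f :=
    congrArg Endofunctor.Coalgebra.Hom.f (hN.hom_ext (determinizationMap L f ≫ hN.from _) _)
  calc f.f ≫ languageMap L hN S'
      = (f.f ≫ T.η.app S'.V) ≫ (hN.from (determinization L S')).f := (Category.assoc _ _ _).symm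
    _ = (T.η.app S.V ≫ T.map f.f) ≫ (hN.from (determinization L S')).f :=
      congrArg (· ≫ (hN.from (determinization L S')).f) (T.η.naturality f.f)
    _ = T.η.app S.V ≫ (determinizationMap L f).f ≫ (hN.from (determinization L S')).f :=
      Category.assoc _ _ _
    _ = languageMap L hN S := congrArg (T.η.app S.V ≫ ·) h

end Naturality

/-- A coalgebra of sets with finite carrier is locally finitely presentable. -/
lemma isLocallyFinitelyPresentable_of_finite {H : Type u ⥤ Type u}
    (S : Endofunctor.Coalgebra H) (hS : Finite S.V) : IsLocallyFinitelyPresentable S :=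
  isLocallyFinitelyPresentable_of_cover fun x => ⟨S, 𝟙 S, x, hS, rfl⟩

end CoalgLang

theorem theorem4p2
    (T : Monad (Type u)) [PreservesFilteredColimits T.toFunctor]
    (hT : CoalgLang.FinitelyGeneratedClosedUnderKernelPairs T.Algebra)
    (F : Type u ⥤ Type u) [PreservesFilteredColimits F]
    (hF : CoalgLang.WeaklyPreservesPullbacks F)
    (L : CoalgLang.Lifting T F)
    -- the final coalgebra `νF`
    (N : Endofunctor.Coalgebra F) (hN : IsTerminal N)
    -- the rational fixpoint `ρ(FT)`
    (R : Endofunctor.Coalgebra (T.toFunctor ⋙ F)) (hR : CoalgLang.IsRationalFixpoint R)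
    -- an expression calculus for `FT`
    (Exp : Type w) (q₀ : Exp → R.V) (hq₀ : Function.Surjective q₀) :
    (∀ E : Exp, ∃ S : Endofunctor.Coalgebra (T.toFunctor ⋙ F), Finite S.V ∧
      ∃ s : S.V, CoalgLang.languageMap L hN S s = CoalgLang.semantics L hN q₀ E) ∧
    (∀ S : Endofunctor.Coalgebra (T.toFunctor ⋙ F), Finite S.V → ∀ s : S.V,
      ∃ E : Exp, CoalgLang.languageMap L hN S s = CoalgLang.semantics L hN q₀ E) := by
  refine ⟨fun E => ?_, fun S hS s => ?_⟩
  · obtain ⟨S, g, s, hS, hs⟩ := CoalgLang.exists_finite_cover hR.lfp (q₀ E)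
    refine ⟨S, hS, s, ?_⟩
    rw [CoalgLang.semantics, ← hs, ← CoalgLang.comp_languageMap L hN g]
    rfl
  · obtain ⟨⟨⟨f⟩, -⟩⟩ := hR.unique_hom S (CoalgLang.isLocallyFinitelyPresentable_of_finite S hS)
    obtain ⟨E, hE⟩ := hq₀ (f.f s)
    refine ⟨E, ?_⟩
    rw [CoalgLang.semantics, hE, ← CoalgLang.comp_languageMap L hN f]
    rfl
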